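/- Let $n$ and $\Delta$ be integers with $2<\Delta<n-1$, and let $\mathcal{T}_n^{\Delta}$ be the set of trees on $n$ vertices with maximum degree $\Delta$. For an edge $e=uv$ of a tree $T$ on $n$ vertices, let $n_u(e)$ and $n_v(e)$ be the numbers of vertices of the components of $T-e$ containing $u$ and $v$, respectively, and put $\mu(e)=\min\{n_u(e),n_v(e)\}$. For $1\le i\le\lfloor n/2\rfloor$ let $r_i(T)$ be the number of edges $e$ of $T$ with $\mu(e)=i$. For trees $T,T'$ on $n$ vertices write $T\preceq T'$ if $$\sum_{i=k}^{\lfloor n/2\rfloor} r_i(T)\le\sum_{i=k}^{\lfloor n/2\rfloor} r_i(T')\qquad\text{for every } k=1,2,\ldots,\lfloor n/2\rfloor .$$ Let $CP_{n;1,\Delta-1}$ be the tree obtained from a path $v_1v_2\cdots v_{n-\Delta}$ by attaching one pendant vertex to $v_1$ and $\Delta-1$ pendant vertices to $v_{n-\Delta}$. Then $CP_{n;1,\Delta-1}\in\mathcal{T}_n^{\Delta}$, and every $T\in\mathcal{T}_n^{\Delta}$ satisfies $$T\preceq CP_{n;1,\Delta-1}.$$ Moreover, equality holds, i.e. $r_i(T)=r_i(CP_{n;1,\Delta-1})$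 for all $1\le i\le\lfloor n/2\rfloor$, if and only if $T$ is isomorphic to $CP_{n;1,\Delta-1}$. -/

import Mathlib

namespace EdgeDivision

universe u v

/-- `n_u(e)` for the edge `e = uv`: the number of vertices of the component of `T - e`
that contains `u`. -/
noncomputable def sideCard {V : Type u} (T : SimpleGraph V) (x y : V) : ℕ :=
  ((T.deleteEdges {s(x, y)}).connectedComponentMk x).supp.ncard

/-- `μ(e) = min {n_u(e), n_v(e)}` for `e = uv`. -/
noncomputable def mu {V : Type u} (T : SimpleGraph V) : Sym2 V → ℕ :=
  Sym2.lift ⟨fun x y => min (sideCard T x y) (sideCard T y x), fun _ _ => min_comm _ _⟩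

/-- `r_i(T)`, the number of edges `e` of `T` with `μ(e) = i`. -/
noncomputable def r {V : Type u} (T : SimpleGraph V) (i : ℕ) : ℕ :=
  {e : Sym2 V | e ∈ T.edgeSet ∧ mu T e = i}.ncard

/-- `T ⪯ T'` for trees `T`, `T'` on `n` vertices (on possibly different vertex types):
`∑_{i=k}^{⌊n/2⌋} r_i(T) ≤ ∑_{i=k}^{⌊n/2⌋} r_i(T')` for every `k = 1, …, ⌊n/2⌋`. -/
def Preceq {V : Type u} {W : Type v} (n : ℕ) (T : SimpleGraph V) (T' : SimpleGraph W) : Prop :=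
  ∀ k ∈ Finset.Icc 1 (n / 2),
    ∑ i ∈ Finset.Icc k (n / 2), r T i ≤ ∑ i ∈ Finset.Icc k (n / 2), r T' i

/-- `T ≈ T'` for trees `T`, `T'` on `n` vertices: the edge division vectors
`(r_1, …, r_{⌊n/2⌋})` of `T` and `T'` are equal. -/
def SameVector {V : Type u} {W : Type v} (n : ℕ) (T : SimpleGraph V) (T' : SimpleGraph W) :
    Prop :=
  ∀ i ∈ Finset.Icc 1 (n / 2), r T i = r T' i

open Classical in
/-- `T` belongs to the class of trees on `n` vertices with maximum degree `Δ`. -/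
structure IsTreeOfMaxDegree {V : Type u} [Fintype V] (n Δ : ℕ) (T : SimpleGraph V) : Prop where
  isTree : T.IsTree
  card_eq : Fintype.card V = n
  maxDegree_eq : T.maxDegree = Δ

/-- The double star path `CP_{n;a,b}`: the path `v_0 ⋯ v_{k-1}` on `k = n - (a + b)` vertices,
with `a` pendant vertices attached to its first vertex `v_0` and `b` pendant vertices attached to
its last vertex `v_{k-1}`. -/
def doubleStarPath (n a b : ℕ) : SimpleGraph (Fin (n - (a + b)) ⊕ (Fin a ⊕ Fin b)) :=
  SimpleGraph.fromRel fun x y =>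
    match x, y with
    | .inl i, .inl j => i.val + 1 = j.val
    | .inr (.inl _), .inl j => j.val = 0
    | .inr (.inr _), .inl j => j.val + 1 = n - (a + b)
    | _, _ => False

end EdgeDivision

/-!
The tail sum `∑_{i≥j} r_i(T)` counts the edges with `μ ≥ j`, so bounding it from above means finding
many edges with `μ < j`. Suppose `j ≥ 2` and some edge `xy` has `μ(xy) ≥ j`. A minimal branch with
at least `j` vertices on either side of `xy` contributes `j - 1` edges with `μ < j`, which gives
`2(j - 1)` of them. If `c` is a vertex of degree `Δ`, say on the side of `y`, then at least `Δ - 1`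
branches at `c` avoid the side of `x`, and each of them contains a pendant edge, which gives
`(j - 1) + (Δ - 1)`. Hence the tail sum is at most `n + 1 - max(j, Δ) - j` (or zero), and
`CP_{n;1,Δ-1}` attains this bound for every `j ≥ 2`.

For the equality case, `deg c + deg x ≤ r_1(T) + 2` for `x ≠ c`, so `r_1(T) = Δ` makes `T` a spider
centred at `c`. Each leg with more than one vertex contains an edge with `μ = 2`, so `r_2(T) ≤ 1`
leaves at most one such leg. Then `T` is a path with pendant vertices at one end, and the distance
from the other end exhibits it as `CP_{n;1,Δ-1}`.
-/

namespace EdgeDivision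

section Sides

variable {V : Type*} {T : SimpleGraph V} {a b c u v w x y : V} {j : ℕ}

/-- The vertex set of the component of `T - xy` that contains `x`; `sideCard T x y` is its size. -/
def side (T : SimpleGraph V) (x y : V) : Set V :=
  {v | (T.deleteEdges {s(x, y)}).Reachable x v}

theorem supp_connectedComponentMk_deleteEdges (T : SimpleGraph V) (x y : V) :
    ((T.deleteEdges {s(x, y)}).connectedComponentMk x).supp = side T x y := by
  ext v
  exact SimpleGraph.ConnectedComponent.eq.trans SimpleGraph.reachable_comm

theorem sideCard_eq_ncard_side (T : SimpleGraph V) (x y : V) :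
    sideCard T x y = (side T x y).ncard := by
  rw [sideCard, supp_connectedComponentMk_deleteEdges]

theorem mu_mk (T : SimpleGraph V) (x y : V) :
    mu T s(x, y) = min (sideCard T x y) (sideCard T y x) := rfl

theorem self_mem_side (T : SimpleGraph V) (x y : V) : x ∈ side T x y :=
  SimpleGraph.Reachable.refl _

theorem mem_side_of_adj (hv : v ∈ side T x y) (h : T.Adj v w) (hne : s(v, w) ≠ s(x, y)) :
    w ∈ side T x y :=
  SimpleGraph.Reachable.trans hv (SimpleGraph.deleteEdges_adj.2 ⟨h, hne⟩).reachable

theorem side_subset_of_forall_adj {C : Set V} (hx : x ∈ C)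
    (hC : ∀ u ∈ C, u ∈ side T x y → ∀ w, T.Adj u w → s(u, w) ≠ s(x, y) → w ∈ C) :
    side T x y ⊆ C := by
  intro v hv
  induction (SimpleGraph.reachable_iff_reflTransGen _ _).1 hv with
  | refl => exact hx
  | @tail u w hxu huw ih =>
    have hu : u ∈ side T x y := (SimpleGraph.reachable_iff_reflTransGen _ _).2 hxu
    obtain ⟨hadj, hne⟩ := SimpleGraph.deleteEdges_adj.1 huw
    exact hC u (ih hu) hu w hadj hne

theorem side_subset_side (ha : a ∈ side T x y) (hx : x ∉ side T a b) :
    side T a b ⊆ side T x y := by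
  refine side_subset_of_forall_adj ha fun u hu hu' w huw hne => mem_side_of_adj hu huw ?_
  intro he
  rcases Sym2.eq_iff.1 he with ⟨rfl, -⟩ | ⟨-, rfl⟩
  · exact hx hu'
  · exact hx (mem_side_of_adj hu' huw hne)

theorem mem_side_or_mem_side (hT : T.Connected) (x y v : V) :
    v ∈ side T x y ∨ v ∈ side T y x := by
  induction (SimpleGraph.reachable_iff_reflTransGen _ _).1 (hT.preconnected x v) with
  | refl => exact Or.inl (self_mem_side T x y)
  | @tail u w _ huw ih =>
    by_cases he : s(u, w) = s(x, y)
    · rcases Sym2.eq_iff.1 he with ⟨-, rfl⟩ | ⟨-, rfl⟩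
      · exact Or.inr (self_mem_side T _ _)
      · exact Or.inl (self_mem_side T _ _)
    · exact ih.imp (mem_side_of_adj · huw he)
        (mem_side_of_adj · huw (by rwa [Sym2.eq_swap (a := y)]))

theorem side_eq_of_forall_adj (hT : T.Connected) {C : Set V} (hx : x ∈ C) (hy : y ∉ C)
    (hC : ∀ u ∈ C, ∀ w, T.Adj u w → s(u, w) ≠ s(x, y) → w ∈ C) : side T x y = C := by
  refine (side_subset_of_forall_adj hx fun u hu _ => hC u hu).antisymm fun v hv => ?_
  have hcompl : side T y x ⊆ Cᶜ := side_subset_of_forall_adj hy fun u hu _ w huw hne hw =>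
    hu (hC w hw u huw.symm (by rwa [Sym2.eq_swap, Sym2.eq_swap (a := x)]))
  exact (mem_side_or_mem_side hT x y v).resolve_right fun h => hcompl h hv

theorem notMem_side (hT : T.IsAcyclic) (h : T.Adj x y) : y ∉ side T x y :=
  SimpleGraph.isBridge_iff.1 (SimpleGraph.isAcyclic_iff_forall_adj_isBridge.1 hT h)

theorem disjoint_side_swap (hT : T.IsAcyclic) (h : T.Adj x y) :
    Disjoint (side T x y) (side T y x) := by
  rw [Set.disjoint_left]
  intro v hv hv'
  rw [side, Sym2.eq_swap] at hv'
  exact notMem_side hT h (SimpleGraph.Reachable.trans hv (SimpleGraph.Reachable.symm hv'))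

theorem compl_side (hT : T.IsTree) (h : T.Adj x y) : (side T x y)ᶜ = side T y x :=
  (Set.compl_subset_iff_union.2 <| Set.eq_univ_of_forall <|
    mem_side_or_mem_side hT.connected x y).antisymm
    (disjoint_side_swap hT.isAcyclic h).subset_compl_left

theorem disjoint_side (hT : T.IsTree) (h : T.Adj a b) (hx : x ∉ side T a b)
    (hb : b ∉ side T x y) : Disjoint (side T x y) (side T a b) := by
  have hxb : x ∈ side T b a := by rwa [← compl_side hT h]
  exact (disjoint_side_swap hT.isAcyclic h).symm.mono_left (side_subset_side hxb hb)

theorem side_ssubset_side (hT : T.IsAcyclic) (h : T.Adj x w) (hne : w ≠ y) :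
    side T w x ⊂ side T x y := by
  have hw : w ∈ side T x y :=
    mem_side_of_adj (self_mem_side T x y) h fun he => hne (Sym2.congr_right.1 he)
  have hx : x ∉ side T w x := notMem_side hT h.symm
  exact ⟨side_subset_side hw hx, fun hsub => hx (hsub (self_mem_side T x y))⟩

theorem pairwiseDisjoint_side (hT : T.IsAcyclic) (c : V) :
    (T.neighborSet c).PairwiseDisjoint (side T · c) := fun _v hv _w hw hne =>
  (disjoint_side_swap hT hw).mono_left (side_ssubset_side hT hv hne).subset

theorem sideCard_add_sideCard [Finite V] (hT : T.IsTree) (h : T.Adj x y) :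
    sideCard T x y + sideCard T y x = Nat.card V := by
  rw [sideCard_eq_ncard_side, sideCard_eq_ncard_side, ← compl_side hT h,
    Set.ncard_add_ncard_compl]

theorem one_le_sideCard [Finite V] (T : SimpleGraph V) (x y : V) : 1 ≤ sideCard T x y := by
  rw [sideCard_eq_ncard_side]
  exact (Set.ncard_pos (Set.toFinite _)).2 ⟨x, self_mem_side T x y⟩

theorem one_le_mu [Finite V] (T : SimpleGraph V) (e : Sym2 V) : 1 ≤ mu T e := by
  induction e with
  | _ x y => exact le_min (one_le_sideCard T x y) (one_le_sideCard T y x)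

theorem two_mul_mu_le [Finite V] (hT : T.IsTree) {e : Sym2 V} (he : e ∈ T.edgeSet) :
    2 * mu T e ≤ Nat.card V := by
  induction e with
  | _ x y =>
    have := sideCard_add_sideCard hT ((SimpleGraph.mem_edgeSet T).1 he)
    rw [mu_mk]
    omega

theorem exists_adj_ne_of_one_lt_sideCard (h : 1 < sideCard T x y) :
    ∃ w, T.Adj x w ∧ w ≠ y := by
  by_contra! hx
  have hsub : side T x y ⊆ {x} := side_subset_of_forall_adj rfl <| by
    rintro u rfl - w huw hne
    exact absurd (by rw [hx w huw]) hne
  rw [sideCard_eq_ncard_side] at h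
  exact h.not_ge (Set.ncard_singleton x ▸ Set.ncard_le_ncard hsub)

theorem exists_minimal_side [Finite V] (h : T.Adj x y) (hj : j ≤ sideCard T x y) :
    ∃ a b, T.Adj a b ∧ side T a b ⊆ side T x y ∧ j ≤ sideCard T a b ∧
      ∀ u v, T.Adj u v → side T u v ⊂ side T a b → sideCard T u v < j := by
  obtain ⟨⟨a, b⟩, ⟨hab, hsub, hle⟩, hmin⟩ := exists_minimalFor_of_wellFoundedLT
    (fun d : V × V => T.Adj d.1 d.2 ∧ side T d.1 d.2 ⊆ side T x y ∧ j ≤ sideCard T d.1 d.2)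
    (fun d => side T d.1 d.2) ⟨(x, y), h, subset_rfl, hj⟩
  refine ⟨a, b, hab, hsub, hle, fun u v huv hlt => ?_⟩
  by_contra! hju
  exact hlt.not_subset (hmin (j := (u, v)) ⟨huv, hlt.subset.trans hsub, hju⟩ hlt.subset)

theorem exists_side_subset_mu_eq_one [Finite V] (hT : T.IsAcyclic) (h : T.Adj x y) :
    ∃ a b, T.Adj a b ∧ side T a b ⊆ side T x y ∧ mu T s(a, b) = 1 := by
  obtain ⟨a, b, hab, hsub, -, hmin⟩ := exists_minimal_side h (one_le_sideCard T x y)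
  have hcard : sideCard T a b ≤ 1 := by
    by_contra! hlt
    obtain ⟨w, haw, hwb⟩ := exists_adj_ne_of_one_lt_sideCard hlt
    exact (one_le_sideCard T w a).not_gt (hmin w a haw.symm (side_ssubset_side hT haw hwb))
  exact ⟨a, b, hab, hsub, ((min_le_left _ _).trans hcard).antisymm (one_le_mu T s(a, b))⟩

end Sides

section Counting

variable {V : Type*} {T : SimpleGraph V} {c v w x y : V} {j : ℕ}

/-- The edges of the component of `T - xy` that contains `x`. -/
def sideEdges (T : SimpleGraph V) (x y : V) : Set (Sym2 V) :=
  {e | e ∈ T.edgeSet ∧ ∀ v ∈ e, v ∈ side T x y}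

/-- The edges `e` with `μ(e) < j`. -/
def lightEdges (T : SimpleGraph V) (j : ℕ) : Set (Sym2 V) :=
  {e | e ∈ T.edgeSet ∧ mu T e < j}

/-- The edges `e` with `μ(e) ≥ j`; for a tree, their number is the tail sum
`∑_{i=j}^{⌊n/2⌋} r_i(T)` in the definition of `⪯`. -/
def heavyEdges (T : SimpleGraph V) (j : ℕ) : Set (Sym2 V) :=
  {e | e ∈ T.edgeSet ∧ j ≤ mu T e}

/-- The neighbours `w` of `c` such that the branch of `T` at `c` through `w` does not contain `x`;
in a tree these are all neighbours of `c` but at most one. -/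
def branchesAvoiding (T : SimpleGraph V) (c x : V) : Set V :=
  {w | T.Adj c w ∧ x ∉ side T w c}

theorem ncard_neighborSet (T : SimpleGraph V) (v : V) [Fintype (T.neighborSet v)] :
    (T.neighborSet v).ncard = T.degree v := by
  rw [Set.ncard_eq_toFinset_card', Set.toFinset_card, SimpleGraph.card_neighborSet_eq_degree]

theorem sideCard_le_ncard_sideEdges_add_one [Finite V] (T : SimpleGraph V) (x y : V) :
    sideCard T x y ≤ (sideEdges T x y).ncard + 1 := by
  set C := (T.deleteEdges {s(x, y)}).connectedComponentMk x
  have hC : ∀ z : C, z.1 ∈ side T x y := fun z =>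
    supp_connectedComponentMk_deleteEdges T x y ▸ z.2
  have hedges : Nat.card C.toSimpleGraph.edgeSet ≤ (sideEdges T x y).ncard := by
    refine Set.ncard_le_ncard_of_injOn (Sym2.map Subtype.val) (fun e he => ?_)
      (Sym2.map.injective Subtype.val_injective).injOn
    induction e with
    | _ u w =>
      refine ⟨(SimpleGraph.deleteEdges_adj.1 he).1, fun z hz => ?_⟩
      obtain ⟨z, -, rfl⟩ := Sym2.mem_map.1 hz
      exact hC z
  exact C.connected_toSimpleGraph.card_vert_le_card_edgeSet_add_one.trans
    (Nat.add_le_add_right hedges 1)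

theorem disjoint_sideEdges (h : Disjoint (side T x y) (side T v w)) :
    Disjoint (sideEdges T x y) (sideEdges T v w) := by
  rw [Set.disjoint_left]
  intro e he he'
  induction e with
  | _ a b =>
    exact Set.disjoint_left.1 h (he.2 a (Sym2.mem_mk_left a b)) (he'.2 a (Sym2.mem_mk_left a b))

theorem le_ncard_lightEdges_inter_sideEdges_add_one [Finite V] (hT : T.IsAcyclic)
    (h : T.Adj x y) (hj : j ≤ sideCard T x y) :
    j ≤ (lightEdges T j ∩ sideEdges T x y).ncard + 1 := by
  obtain ⟨a, b, -, hsub, hle, hmin⟩ := exists_minimal_side h hj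
  have hlight : ∀ u v, T.Adj u v → u ∈ side T a b → v ∈ side T a b → a ∉ side T u v →
      mu T s(u, v) < j := fun u v huv hu hv ha =>
    (min_le_left _ _).trans_lt <| hmin u v huv
      ⟨side_subset_side hu ha, fun hss => notMem_side hT huv (hss hv)⟩
  refine hle.trans <| (sideCard_le_ncard_sideEdges_add_one T a b).trans <|
    Nat.add_le_add_right (Set.ncard_le_ncard fun e he => ?_) 1
  refine ⟨⟨he.1, ?_⟩, he.1, fun z hz => hsub (he.2 z hz)⟩
  induction e with
  | _ u v =>
    have hu := he.2 u (Sym2.mem_mk_left u v)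
    have hv := he.2 v (Sym2.mem_mk_right u v)
    by_cases ha : a ∈ side T u v
    · rw [Sym2.eq_swap]
      exact hlight v u he.1.symm hv hu (Set.disjoint_left.1 (disjoint_side_swap hT he.1) ha)
    · exact hlight u v he.1 hu hv ha

theorem ncard_le_ncard_of_side_subset [Finite V] {ι : Type*} {I : Set ι} {B : ι → Set V}
    {S : Set (Sym2 V)} (hT : T.Connected) (hB : I.PairwiseDisjoint B) (hv : ∀ i ∈ I, v ∉ B i)
    (hI : ∀ i ∈ I, ∃ a b, side T a b ⊆ B i ∧ s(a, b) ∈ S) : I.ncard ≤ S.ncard := by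
  have := hT.nonempty
  choose! a b hsub hmem using hI
  refine Set.ncard_le_ncard_of_injOn (fun i => s(a i, b i)) hmem fun i hi k hk hik => ?_
  by_contra hne
  rcases Sym2.eq_iff.1 hik with ⟨hab, -⟩ | ⟨hab, hba⟩
  · exact Set.disjoint_left.1 (hB hi hk hne) (hsub i hi (self_mem_side T _ _))
      (hsub k hk (hab ▸ self_mem_side T _ _))
  -- The two sides of an edge cover every vertex, so `v` would lie in `B i` or in `B k`.
  · exact (mem_side_or_mem_side hT (a i) (b i) v).elim (fun h => hv i hi (hsub i hi h))
      fun h => hv k hk (hsub k hk (by rwa [← hab, ← hba]))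

theorem degree_le_ncard_branchesAvoiding_add_one [T.LocallyFinite] (hT : T.IsAcyclic) (c x : V) :
    T.degree c ≤ (branchesAvoiding T c x).ncard + 1 := by
  have hfin : (T.neighborSet c).Finite := Set.toFinite _
  have hle : (T.neighborSet c \ branchesAvoiding T c x).ncard ≤ 1 := by
    rw [Set.ncard_le_one (hfin.subset Set.sdiff_subset)]
    rintro a ⟨ha, ha'⟩ b ⟨hb, hb'⟩
    by_contra hne
    exact Set.disjoint_left.1 (pairwiseDisjoint_side hT c ha hb hne)
      (not_not.1 fun hx => ha' ⟨ha, hx⟩) (not_not.1 fun hx => hb' ⟨hb, hx⟩)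
  rw [← ncard_neighborSet]
  have := Set.ncard_le_ncard_sdiff_add_ncard (T.neighborSet c) (branchesAvoiding T c x)
    (hfin.subset fun w hw => hw.1)
  omega

theorem two_mul_le_ncard_lightEdges_add_two [Finite V] (hT : T.IsAcyclic) (h : T.Adj x y)
    (hj : j ≤ mu T s(x, y)) : 2 * j ≤ (lightEdges T j).ncard + 2 := by
  have hx := le_ncard_lightEdges_inter_sideEdges_add_one hT h (hj.trans (min_le_left _ _))
  have hy := le_ncard_lightEdges_inter_sideEdges_add_one hT h.symm (hj.trans (min_le_right _ _))
  have hunion := Set.ncard_union_eq <| (disjoint_sideEdges (disjoint_side_swap hT h)).mono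
    (Set.inter_subset_right (s := lightEdges T j)) (Set.inter_subset_right (s := lightEdges T j))
  have hsub : (lightEdges T j ∩ sideEdges T x y ∪ lightEdges T j ∩ sideEdges T y x).ncard ≤
      (lightEdges T j).ncard :=
    Set.ncard_le_ncard (Set.union_subset Set.inter_subset_left Set.inter_subset_left)
  omega

theorem degree_add_le_ncard_lightEdges_add_two [Finite V] [T.LocallyFinite] (hT : T.IsTree)
    (hj₂ : 2 ≤ j) (c : V) (h : T.Adj x y) (hj : j ≤ mu T s(x, y)) :
    T.degree c + j ≤ (lightEdges T j).ncard + 2 := by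
  wlog hc : c ∉ side T x y generalizing x y
  · refine this h.symm (by rwa [Sym2.eq_swap]) ?_
    exact Set.disjoint_left.1 (disjoint_side_swap hT.isAcyclic h) (not_not.1 hc)
  have hdegree := degree_le_ncard_branchesAvoiding_add_one hT.isAcyclic c x
  have hinside := le_ncard_lightEdges_inter_sideEdges_add_one hT.isAcyclic h
    (hj.trans (min_le_left _ _))
  have houtside : (branchesAvoiding T c x).ncard ≤ (lightEdges T j \ sideEdges T x y).ncard := by
    refine ncard_le_ncard_of_side_subset hT.connected
      ((pairwiseDisjoint_side hT.isAcyclic c).subset fun w hw => hw.1)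
      (fun w hw => notMem_side hT.isAcyclic hw.1.symm) fun w hw => ?_
    obtain ⟨a, b, hab, hsub, hmu⟩ := exists_side_subset_mu_eq_one hT.isAcyclic hw.1.symm
    refine ⟨a, b, hsub, ⟨hab, hmu.trans_lt hj₂⟩, fun he => ?_⟩
    exact Set.disjoint_left.1 (disjoint_side hT hw.1.symm hw.2 hc)
      (he.2 a (Sym2.mem_mk_left a b)) (hsub (self_mem_side T a b))
  have := Set.ncard_inter_add_ncard_sdiff_eq_ncard (lightEdges T j) (sideEdges T x y)
  omega

theorem ncard_edgeSet_add_one [Finite V] (hT : T.IsTree) : T.edgeSet.ncard + 1 = Nat.card V :=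
  (SimpleGraph.isTree_iff_connected_and_card.1 hT).2

theorem ncard_heavyEdges_add_ncard_lightEdges [Finite V] (T : SimpleGraph V) (j : ℕ) :
    (heavyEdges T j).ncard + (lightEdges T j).ncard = T.edgeSet.ncard := by
  rw [← Set.ncard_inter_add_ncard_sdiff_eq_ncard T.edgeSet {e | j ≤ mu T e}]
  congr 2
  ext e
  exact and_congr_right fun _ => not_le.symm

theorem ncard_heavyEdges_le [Finite V] [T.LocallyFinite] (hT : T.IsTree) (c : V) (hj : 2 ≤ j) :
    (heavyEdges T j).ncard ≤ Nat.card V + 1 - max j (T.degree c) - j := by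
  rcases (heavyEdges T j).eq_empty_or_nonempty with hempty | ⟨e, he, hmu⟩
  · simp only [hempty, Set.ncard_empty, zero_le]
  · induction e with
    | _ x y =>
      have htwo := two_mul_le_ncard_lightEdges_add_two hT.isAcyclic he hmu
      have hdegree := degree_add_le_ncard_lightEdges_add_two hT hj c he hmu
      have hadd := ncard_heavyEdges_add_ncard_lightEdges T j
      have hcard := ncard_edgeSet_add_one hT
      omega

theorem heavyEdges_one [Finite V] (T : SimpleGraph V) : heavyEdges T 1 = T.edgeSet :=
  Set.sep_eq_self_iff_mem_true.2 fun e _ => one_le_mu T e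

theorem ncard_heavyEdges_eq_r_add [Finite V] (T : SimpleGraph V) (j : ℕ) :
    (heavyEdges T j).ncard = r T j + (heavyEdges T (j + 1)).ncard := by
  rw [← Set.ncard_inter_add_ncard_sdiff_eq_ncard (heavyEdges T j) {e | mu T e = j}, r]
  congr 2 <;> ext e
  · exact ⟨fun h => ⟨h.1.1, h.2⟩, fun h => ⟨⟨h.1, h.2.ge⟩, h.2⟩⟩
  · exact ⟨fun h => ⟨h.1.1, lt_of_le_of_ne h.1.2 (Ne.symm h.2)⟩,
      fun h => ⟨⟨h.1, Nat.le_of_succ_le h.2⟩, Nat.ne_of_gt h.2⟩⟩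

theorem heavyEdges_eq_empty [Finite V] (hT : T.IsTree) (hj : Nat.card V / 2 < j) :
    heavyEdges T j = ∅ := by
  refine Set.eq_empty_of_forall_notMem fun e he => ?_
  have := two_mul_mu_le hT he.1
  have := he.2
  omega

theorem sum_r_eq_ncard_heavyEdges [Finite V] (hT : T.IsTree) (j : ℕ) :
    ∑ i ∈ Finset.Icc j (Nat.card V / 2), r T i = (heavyEdges T j).ncard := by
  rcases lt_or_ge (Nat.card V / 2) j with hj | hj
  · rw [Finset.Icc_eq_empty_of_lt hj, Finset.sum_empty, heavyEdges_eq_empty hT hj, Set.ncard_empty]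
  · induction hj using Nat.decreasingInduction with
    | self =>
      rw [Finset.Icc_self, Finset.sum_singleton, ncard_heavyEdges_eq_r_add,
        heavyEdges_eq_empty hT (Nat.lt_succ_self _), Set.ncard_empty, add_zero]
    | of_succ j hj ih =>
      rw [ncard_heavyEdges_eq_r_add, ← ih, ← Finset.add_sum_Ioc_eq_sum_Icc hj.le,
        ← Finset.Icc_add_one_left_eq_Ioc]

end Counting

section Isomorphism

variable {V W : Type*} {T : SimpleGraph V} {T' : SimpleGraph W}

theorem preimage_side_iso (f : T ≃g T') (x y : V) : f ⁻¹' side T' (f x) (f y) = side T x y := by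
  let g : T.deleteEdges {s(x, y)} ≃g T'.deleteEdges {s(f x, f y)} :=
    ⟨f.toEquiv, by simp [SimpleGraph.deleteEdges_adj, f.map_adj_iff]⟩
  ext v
  exact g.reachable_iff

theorem sideCard_iso (f : T ≃g T') (x y : V) : sideCard T' (f x) (f y) = sideCard T x y := by
  rw [sideCard_eq_ncard_side, sideCard_eq_ncard_side, ← preimage_side_iso f,
    Set.ncard_preimage_of_injective_subset_range f.injective (by simp [f.surjective.range_eq])]

theorem mu_iso (f : T ≃g T') (e : Sym2 V) : mu T' (e.map f) = mu T e := by
  induction e with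
  | _ x y => simp only [Sym2.map_mk, mu_mk, sideCard_iso]

theorem r_iso (f : T ≃g T') (i : ℕ) : r T i = r T' i := by
  have hsurj : Function.Surjective (Sym2.map f) := fun e =>
    ⟨e.map f.symm, by rw [Sym2.map_map, f.self_comp_symm, Sym2.map_id, id]⟩
  rw [r, r, ← Set.ncard_preimage_of_injective_subset_range (Sym2.map.injective f.injective)
    (hsurj.range_eq ▸ Set.subset_univ _)]
  congr 1
  ext e
  exact and_congr f.map_mem_edgeSet_iff.symm (by rw [mu_iso])

end Isomorphism

section Broom

/-- `p` is a height function that shows `G` to be a path with vertices at heights `0, …, k`,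
together with pendant vertices at height `k + 1` attached to the path's vertex at height `k`. -/
structure IsBroomHeight {W : Type*} (G : SimpleGraph W) (k : ℕ) (p : W → ℕ) : Prop where
  adj_iff : ∀ x y, G.Adj x y ↔ p x + 1 = p y ∨ p y + 1 = p x
  le : ∀ x, p x ≤ k + 1
  surj : ∀ m ≤ k + 1, ∃ x, p x = m
  inj : ∀ x y, p x = p y → p x ≤ k → x = y

namespace IsBroomHeight

variable {V W : Type*} {G : SimpleGraph W} {k j : ℕ} {p : W → ℕ} {c x y : W}

theorem connected (h : IsBroomHeight G k p) : G.Connected := by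
  obtain ⟨o, ho⟩ := h.surj 0 (Nat.zero_le _)
  have hreach : ∀ m x, p x = m → G.Reachable o x := by
    intro m
    induction m with
    | zero =>
      intro x hx
      rw [h.inj o x (by omega) (by omega)]
    | succ m ih =>
      intro x hx
      obtain ⟨u, hu⟩ := h.surj m (by have := h.le x; omega)
      exact (ih u hu).trans ((h.adj_iff u x).2 (Or.inl (by omega))).reachable
  exact (SimpleGraph.connected_iff_exists_forall_reachable G).2 ⟨o, fun x => hreach _ x rfl⟩

theorem side_eq (h : IsBroomHeight G k p) (hxy : p x + 1 = p y) :
    side G x y = {z | z ≠ y ∧ p z ≤ p y} := by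
  refine side_eq_of_forall_adj h.connected ⟨fun he => by subst he; omega, by omega⟩
    (fun hy => hy.1 rfl) ?_
  rintro a ⟨hay, ha⟩ b hab hne
  have hy := h.le y
  have hb := h.le b
  rcases (h.adj_iff a b).1 hab with hup | hdown
  · have hlt : p a < p y := ha.lt_of_ne fun he => hay (h.inj a y he (by omega))
    refine ⟨?_, by omega⟩
    rintro rfl
    exact hne (by rw [h.inj a x (by omega) (by omega)])
  · refine ⟨?_, by omega⟩
    rintro rfl
    omega

theorem isTree (h : IsBroomHeight G k p) : G.IsTree := by
  have hbridge : ∀ x y, p x + 1 = p y → G.IsBridge s(x, y) := fun x y hxy =>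
    SimpleGraph.isBridge_iff.2 fun hy => (h.side_eq hxy ▸ hy : y ∈ {z | z ≠ y ∧ p z ≤ p y}).1 rfl
  refine ⟨h.connected, SimpleGraph.isAcyclic_iff_forall_adj_isBridge.2 fun x y hxy => ?_⟩
  rcases (h.adj_iff x y).1 hxy with hup | hdown
  · exact hbridge x y hup
  · exact Sym2.eq_swap (a := x) ▸ hbridge y x hdown

theorem ncard_setOf_lt (h : IsBroomHeight G k p) (hj : j ≤ k + 1) : {x | p x < j}.ncard = j := by
  have hbij : Set.BijOn p {x | p x < j} (Set.Iio j) :=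
    ⟨fun _ hx => hx, fun x (hx : p x < j) y _ hxy => h.inj x y hxy (by omega),
      fun m (hm : m < j) => (h.surj m (by omega)).imp fun x hx => ⟨hx.trans_lt hm, hx⟩⟩
  rw [← hbij.injOn.ncard_image, hbij.image_eq, Set.ncard_eq_toFinset_card', Set.toFinset_Iio,
    Nat.card_Iio]

theorem ncard_setOf_eq_top_add [Finite W] (h : IsBroomHeight G k p) :
    {x | p x = k + 1}.ncard + (k + 1) = Nat.card W := by
  have hcompl : {x | p x = k + 1} = {x | p x < k + 1}ᶜ := by
    ext x
    exact (h.le x).not_lt_iff_eq.symm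
  rw [hcompl, add_comm, ← Set.ncard_add_ncard_compl {x | p x < k + 1}, h.ncard_setOf_lt le_rfl]

theorem ncard_setOf_eq (h : IsBroomHeight G k p) (hj : j ≤ k) : {x | p x = j}.ncard = 1 := by
  obtain ⟨x, hx⟩ := h.surj j (by omega)
  exact Set.ncard_eq_one.2 ⟨x, Set.eq_singleton_iff_unique_mem.2
    ⟨hx, fun y (hy : p y = j) => h.inj y x (hy.trans hx.symm) (by omega)⟩⟩

theorem nonempty_iso {G' : SimpleGraph V} {p' : V → ℕ} [Finite W] [Finite V]
    (h : IsBroomHeight G k p) (h' : IsBroomHeight G' k p') (hcard : Nat.card W = Nat.card V) :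
    Nonempty (G ≃g G') := by
  have hfiber : ∀ m, {x | p x = m}.ncard = {x | p' x = m}.ncard := by
    intro m
    rcases lt_trichotomy m (k + 1) with hm | rfl | hm
    · rw [h.ncard_setOf_eq (by omega), h'.ncard_setOf_eq (by omega)]
    · have := h.ncard_setOf_eq_top_add
      have := h'.ncard_setOf_eq_top_add
      omega
    · have hempty : {x | p x = m} = ∅ ∧ {x | p' x = m} = ∅ :=
        ⟨Set.eq_empty_of_forall_notMem fun x hx => ((h.le x).trans_lt hm).ne hx,
          Set.eq_empty_of_forall_notMem fun x hx => ((h'.le x).trans_lt hm).ne hx⟩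
      rw [hempty.1, hempty.2, Set.ncard_empty, Set.ncard_empty]
  let f : W ≃ V := Equiv.ofFiberEquiv fun m => (Finite.card_eq.1 (hfiber m)).some
  have hf : ∀ x, p' (f x) = p x := Equiv.ofFiberEquiv_map _
  exact ⟨f, fun {x y} => by rw [h'.adj_iff, h.adj_iff, hf, hf]⟩

theorem degree_add_eq_card [Finite W] [G.LocallyFinite] (h : IsBroomHeight G k p) (hk : 1 ≤ k)
    (hc : p c = k) : G.degree c + k = Nat.card W := by
  obtain ⟨d, hd⟩ := h.surj (k - 1) (by omega)
  have hneighbors : G.neighborSet c = insert d {x | p x = k + 1} := by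
    ext x
    refine (h.adj_iff c x).trans ⟨?_, ?_⟩
    · rintro (hup | hdown)
      · exact Or.inr (hup.symm.trans (by rw [hc]))
      · exact Or.inl (h.inj x d (by omega) (by omega))
    · rintro (rfl | (hx : p x = k + 1)) <;> omega
  have hd' : d ∉ {x | p x = k + 1} := fun (he : p d = k + 1) => by omega
  rw [← ncard_neighborSet, hneighbors, Set.ncard_insert_of_notMem hd', ← h.ncard_setOf_eq_top_add]
  omega

theorem degree_le_two [G.LocallyFinite] (h : IsBroomHeight G k p) (hx : p x ≠ k) :
    G.degree x ≤ 2 := by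
  rw [← ncard_neighborSet, ← Set.ncard_pair (show p x - 1 ≠ p x + 1 by omega)]
  refine Set.ncard_le_ncard_of_injOn p (fun y hy => ?_) fun y hy z _ hyz => ?_
  · rcases (h.adj_iff x y).1 hy with hup | hdown
    · exact Or.inr hup.symm
    · exact Or.inl (by omega)
  · have := (h.adj_iff x y).1 hy
    have := h.le x
    have := h.le y
    exact h.inj y z hyz (by omega)

theorem isTreeOfMaxDegree [Fintype W] {n Δ : ℕ} (h : IsBroomHeight G k p) (hk : 1 ≤ k)
    (hn : Fintype.card W = n) (hΔ : Δ + k = n) (hΔ₂ : 2 ≤ Δ) : IsTreeOfMaxDegree n Δ G := by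
  classical
  obtain ⟨c, hc⟩ := h.surj k (by omega)
  have hdegree := h.degree_add_eq_card hk hc
  rw [Nat.card_eq_fintype_card, hn] at hdegree
  refine ⟨h.isTree, hn, le_antisymm (SimpleGraph.maxDegree_le_of_forall_degree_le _ _ ?_) ?_⟩
  · intro v
    by_cases hv : p v = k
    · rw [h.inj v c (by omega) (by omega)]
      omega
    · exact (h.degree_le_two hv).trans hΔ₂
  · exact le_trans (by omega) (G.degree_le_maxDegree c)

theorem sideCard_eq (h : IsBroomHeight G k p) (hxy : p x + 1 = p y) (hy : p y ≤ k) :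
    sideCard G x y = p y := by
  have hside : {z | z ≠ y ∧ p z ≤ p y} = {z | p z < p y} := by
    ext z
    refine ⟨fun hz => hz.2.lt_of_ne fun he => hz.1 (h.inj z y he (by omega)),
      fun (hz : p z < p y) => ⟨?_, hz.le⟩⟩
    rintro rfl
    exact lt_irrefl _ hz
  rw [sideCard_eq_ncard_side, h.side_eq hxy, hside, h.ncard_setOf_lt (by omega)]

theorem le_ncard_heavyEdges [Finite W] (h : IsBroomHeight G k p) (hj : 1 ≤ j) :
    Nat.card W + 1 - max j (Nat.card W - k) - j ≤ (heavyEdges G j).ncard := by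
  have hpath : Set.Icc j (min (Nat.card W - j) k) ⊆
      (fun e => (Sym2.map p e).sup) '' heavyEdges G j := by
    rintro i ⟨hji, hi⟩
    obtain ⟨x, hx⟩ := h.surj (i - 1) (by omega)
    obtain ⟨y, hy⟩ := h.surj i (by omega)
    have hadj : G.Adj x y := (h.adj_iff x y).2 (Or.inl (by omega))
    have hside := h.sideCard_eq (x := x) (y := y) (by omega) (by omega)
    have hsum := sideCard_add_sideCard h.isTree hadj
    refine ⟨s(x, y), ⟨hadj, by rw [mu_mk]; omega⟩, ?_⟩
    simp only [Sym2.map_mk, Sym2.sup_mk, hx, hy]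
    omega
  have := h.ncard_setOf_eq_top_add
  calc _ ≤ (Set.Icc j (min (Nat.card W - j) k)).ncard := by
        rw [Set.ncard_eq_toFinset_card', Set.toFinset_Icc, Nat.card_Icc]
        omega
    _ ≤ _ := (Set.ncard_le_ncard hpath).trans Set.ncard_image_le

theorem preceq [Finite V] [Finite W] {T : SimpleGraph V} [T.LocallyFinite]
    (h : IsBroomHeight G k p) (hT : T.IsTree) (hcard : Nat.card V = Nat.card W) {c : V}
    (hc : T.degree c + k = Nat.card V) : Preceq (Nat.card V) T G := by
  intro j hj
  rw [sum_r_eq_ncard_heavyEdges hT, hcard, sum_r_eq_ncard_heavyEdges h.isTree]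
  rcases (Finset.mem_Icc.1 hj).1.eq_or_lt with rfl | hj
  · rw [heavyEdges_one, heavyEdges_one]
    have := ncard_edgeSet_add_one hT
    have := ncard_edgeSet_add_one h.isTree
    omega
  · have := ncard_heavyEdges_le hT c hj
    have := h.le_ncard_heavyEdges hj.le
    omega

theorem r_one_add_le [Finite W] (h : IsBroomHeight G k p) (hk : k + 2 ≤ Nat.card W) :
    r G 1 + k ≤ Nat.card W := by
  have hsplit : (heavyEdges G 1).ncard = r G 1 + (heavyEdges G 2).ncard :=
    ncard_heavyEdges_eq_r_add G 1
  rw [heavyEdges_one] at hsplit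
  have := h.le_ncard_heavyEdges (j := 2) (by omega)
  have := ncard_edgeSet_add_one h.isTree
  omega

theorem r_two_le_one [Finite W] (h : IsBroomHeight G k p) (hk : 1 ≤ k)
    (hcard : k + 3 ≤ Nat.card W) : r G 2 ≤ 1 := by
  classical
  have := Fintype.ofFinite W
  obtain ⟨c, hc⟩ := h.surj k (by omega)
  have := h.degree_add_eq_card hk hc
  have : (heavyEdges G 2).ncard = r G 2 + (heavyEdges G 3).ncard := ncard_heavyEdges_eq_r_add G 2
  have := ncard_heavyEdges_le h.isTree c le_rfl
  have := h.le_ncard_heavyEdges (j := 3) (by omega)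
  omega

end IsBroomHeight

/-- The height function exhibiting `CP_{n;1,b}` as a broom: its single pendant vertex at `v_0`
becomes the end of the path at height `0`. -/
def doubleStarPathHeight (n b : ℕ) : Fin (n - (1 + b)) ⊕ (Fin 1 ⊕ Fin b) → ℕ
  | .inl i => i.val + 1
  | .inr (.inl _) => 0
  | .inr (.inr _) => n - (1 + b) + 1

theorem isBroomHeight_doubleStarPath {n b : ℕ} (hb : 1 ≤ b) (hn : 1 + b < n) :
    IsBroomHeight (doubleStarPath n 1 b) (n - (1 + b)) (doubleStarPathHeight n b) where
  adj_iff := by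
    rintro (i | i | i) (j | j | j) <;>
      simp only [doubleStarPath, doubleStarPathHeight, SimpleGraph.fromRel_adj, ne_eq,
        Sum.inl.injEq, Sum.inr.injEq, reduceCtorEq, not_false_eq_true, true_and, or_false, false_or,
        and_false, or_self, false_iff, Fin.ext_iff] <;> omega
  le := by
    rintro (i | i | i) <;> simp only [doubleStarPathHeight] <;> omega
  surj := by
    intro m hm
    rcases Nat.eq_zero_or_pos m with rfl | hpos
    · exact ⟨.inr (.inl 0), rfl⟩
    · rcases hm.eq_or_lt with rfl | hlt
      · exact ⟨.inr (.inr ⟨0, hb⟩), rfl⟩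
      · exact ⟨.inl ⟨m - 1, by omega⟩, Nat.sub_add_cancel hpos⟩
  inj := by
    rintro (i | i | i) (j | j | j) <;>
      simp only [doubleStarPathHeight, Sum.inl.injEq, Sum.inr.injEq, reduceCtorEq, false_imp_iff,
        true_imp_iff, Fin.ext_iff] <;> omega

end Broom

section BroomRecognition

variable {V : Type*} {T : SimpleGraph V} {c o u v w x y : V}

theorem exists_adj_dist_add_one_eq (hT : T.Connected) (hv : v ≠ o) :
    ∃ u, T.Adj u v ∧ T.dist o u + 1 = T.dist o v := by
  obtain ⟨q, hq⟩ := hT.exists_walk_length_eq_dist v o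
  cases q with
  | nil => exact absurd rfl hv
  | @cons _ u _ h q =>
    refine ⟨u, h.symm, le_antisymm ?_ ?_⟩
    · rw [T.dist_comm (u := o) (v := v), ← hq, T.dist_comm, SimpleGraph.Walk.length_cons]
      exact Nat.add_le_add_right (SimpleGraph.dist_le q) 1
    · exact (hT.dist_triangle (v := u)).trans_eq
        (by rw [SimpleGraph.dist_eq_one_iff_adj.2 h.symm])

theorem exists_dist_eq_of_le (hT : T.Connected) (o : V) {m : ℕ} (hm : m ≤ T.dist o v) :
    ∃ u, T.dist o u = m := by
  induction hm using Nat.decreasingInduction with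
  | self => exact ⟨v, rfl⟩
  | of_succ m _ ih =>
    obtain ⟨u, hu⟩ := ih
    have huo : u ≠ o := by
      rintro rfl
      exact absurd (hu.symm.trans SimpleGraph.dist_self) m.succ_ne_zero
    obtain ⟨w, -, hw⟩ := exists_adj_dist_add_one_eq hT huo
    exact ⟨w, by omega⟩

theorem eq_of_adj_of_dist_add_one_eq (hT : T.IsTree) (hu : T.Adj u v) (hw : T.Adj w v)
    (hdu : T.dist o u + 1 = T.dist o v) (hdw : T.dist o w + 1 = T.dist o v) : u = w := by
  obtain ⟨p, hp⟩ := hT.connected.exists_walk_length_eq_dist o u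
  obtain ⟨q, hq⟩ := hT.connected.exists_walk_length_eq_dist o w
  have hpu := (p.concat hu).isPath_of_length_eq_dist (by rw [p.length_concat, hp, hdu])
  have hqw := (q.concat hw).isPath_of_length_eq_dist (by rw [q.length_concat, hq, hdw])
  have heq : p.concat hu = q.concat hw :=
    congrArg Subtype.val ((hT.isAcyclic.subsingleton_path o v).elim ⟨_, hpu⟩ ⟨_, hqw⟩)
  rw [← p.penultimate_concat hu, ← q.penultimate_concat hw, heq]

theorem eq_or_eq_of_degree_le_two [Fintype (T.neighborSet v)] (hdeg : T.degree v ≤ 2)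
    (hu : T.Adj v u) (hw : T.Adj v w) (hne : u ≠ w) (hx : T.Adj v x) : x = u ∨ x = w := by
  by_contra! hxne
  refine hdeg.not_gt (Finset.two_lt_card.2 ⟨u, ?_, w, ?_, x, ?_, hne, hxne.1.symm, hxne.2.symm⟩) <;>
    rwa [SimpleGraph.mem_neighborFinset]

theorem eq_of_dist_eq_of_le [T.LocallyFinite] (hT : T.IsTree)
    (hdeg : ∀ v ≠ c, T.degree v ≤ 2) (ho : ∀ v, T.dist c v ≤ T.dist c o)
    (hxy : T.dist o x = T.dist o y) (hx : T.dist o x ≤ T.dist o c) : x = y := by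
  induction hm : T.dist o x generalizing x y with
  | zero =>
    exact ((hT.connected.dist_eq_zero_iff).1 hm).symm.trans
      (hT.connected.dist_eq_zero_iff.1 (hxy.symm.trans hm))
  | succ m ih =>
    have hne : ∀ z, T.dist o z = m + 1 → z ≠ o := by
      rintro z hz rfl
      exact absurd (hz.symm.trans SimpleGraph.dist_self) m.succ_ne_zero
    obtain ⟨u, hux, hu⟩ := exists_adj_dist_add_one_eq hT.connected (hne x hm)
    obtain ⟨w, hwy, hw⟩ := exists_adj_dist_add_one_eq hT.connected (hne y (hxy ▸ hm))
    obtain rfl : u = w := ih (by omega) (by omega) (by omega)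
    by_cases huo : u = o
    -- Since `o` is farthest from `c`, all its neighbours are nearer to `c`, so there is only one.
    · subst huo
      have hparent : ∀ z, T.Adj u z → T.dist c z + 1 = T.dist c u := fun z hz => by
        have := hT.dist_eq_dist_add_one_of_adj c hz
        have := ho z
        omega
      exact eq_of_adj_of_dist_add_one_eq hT hux.symm hwy.symm (hparent x hux) (hparent y hwy)
    · obtain ⟨z, hzu, hz⟩ := exists_adj_dist_add_one_eq hT.connected huo
      have huc : u ≠ c := by rintro rfl; omega
      have hzx : z ≠ x := by rintro rfl; omega
      rcases eq_or_eq_of_degree_le_two (hdeg u huc) hzu.symm hux hzx hwy with rfl | rfl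
      · omega
      · rfl

theorem dist_le_dist_add_one [T.LocallyFinite] (hT : T.IsTree)
    (hdeg : ∀ v ≠ c, T.degree v ≤ 2) (ho : ∀ v, T.dist c v ≤ T.dist c o)
    (hbranch : {w | T.Adj c w ∧ 1 < T.degree w}.Subsingleton) (x : V) :
    T.dist o x ≤ T.dist o c + 1 := by
  by_contra! hx
  obtain ⟨x, hx⟩ := exists_dist_eq_of_le hT.connected o hx.nat_succ_le
  have hne : ∀ z, T.dist o z ≠ 0 → z ≠ o := by
    rintro z hz rfl
    exact hz SimpleGraph.dist_self
  have hone : ∀ {z w a}, T.Adj z w → T.Adj z a → w ≠ a → 1 < T.degree z := fun {z w a} hw ha hwa =>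
    Finset.one_lt_card.2 ⟨w, by rwa [SimpleGraph.mem_neighborFinset], a,
      by rwa [SimpleGraph.mem_neighborFinset], hwa⟩
  obtain ⟨u, hux, hu⟩ := exists_adj_dist_add_one_eq hT.connected (hne x (by omega))
  obtain ⟨w, hwu, hw⟩ := exists_adj_dist_add_one_eq hT.connected (hne u (by omega))
  obtain rfl : w = c := eq_of_dist_eq_of_le hT hdeg ho (by omega) (by omega)
  have htriangle := hT.connected.dist_triangle (u := o) (v := w) (w := x)
  have hfar := ho x
  rw [T.dist_comm (v := o)] at hfar
  obtain ⟨d, hdw, hd⟩ := exists_adj_dist_add_one_eq hT.connected (hne w (by omega))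
  obtain ⟨e, hed, he⟩ := exists_adj_dist_add_one_eq hT.connected (hne d (by omega))
  -- The neighbours of `c` on the way to `o` and on the way to `x` both have degree at least two.
  have hdu : d = u := hbranch ⟨hdw.symm, hone hdw hed.symm (by rintro rfl; omega)⟩
    ⟨hwu, hone hwu.symm hux (by rintro rfl; omega)⟩
  subst hdu
  omega

theorem exists_isBroomHeight_dist [Finite V] [T.LocallyFinite] (hT : T.IsTree)
    (hc : 1 < T.degree c) (hdeg : ∀ v ≠ c, T.degree v ≤ 2)
    (hbranch : {w | T.Adj c w ∧ 1 < T.degree w}.Subsingleton) :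
    ∃ o, 1 ≤ T.dist o c ∧ IsBroomHeight T (T.dist o c) (T.dist o) := by
  have := hT.connected.nonempty
  obtain ⟨o, ho⟩ := Finite.exists_max (T.dist c)
  have hle := dist_le_dist_add_one hT hdeg ho hbranch
  obtain ⟨a, ha, b, hb, hab⟩ := Finset.one_lt_card.1 hc
  rw [SimpleGraph.mem_neighborFinset] at ha hb
  refine ⟨o, ?_, fun x y => ?_, hle, fun m hm => ?_, fun x y => eq_of_dist_eq_of_le hT hdeg ho⟩
  · rw [T.dist_comm, ← SimpleGraph.dist_eq_one_iff_adj.2 ha]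
    exact ho a
  · refine ⟨fun h => ?_, ?_⟩
    · exact (hT.dist_eq_dist_add_one_of_adj o h).symm.imp Eq.symm Eq.symm
    have hadj : ∀ x y, T.dist o x + 1 = T.dist o y → T.Adj x y := fun x y hxy => by
      have hy := hle y
      obtain ⟨u, huy, hu⟩ := exists_adj_dist_add_one_eq (o := o) (v := y) hT.connected <| by
        rintro rfl
        exact absurd (hxy.trans SimpleGraph.dist_self) (Nat.succ_ne_zero _)
      rwa [eq_of_dist_eq_of_le hT hdeg ho (show T.dist o x = T.dist o u by omega) (by omega)]
    rintro (h | h)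
    · exact hadj x y h
    · exact (hadj y x h).symm
  · rcases hm.lt_or_eq with hlt | rfl
    · exact exists_dist_eq_of_le hT.connected o (Nat.lt_succ_iff.1 hlt)
    · by_contra! hnone
      have hparent : ∀ z, T.Adj c z → T.dist o z + 1 = T.dist o c := fun z hz =>
        ((hT.dist_eq_dist_add_one_of_adj o hz).resolve_right (hnone z)).symm
      exact hab (eq_of_adj_of_dist_add_one_eq hT ha.symm hb.symm (hparent a ha) (hparent b hb))

end BroomRecognition

section Uniqueness

variable {V : Type*} {T : SimpleGraph V} {c w x y : V} {j : ℕ}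

theorem disjoint_side_of_mem_branchesAvoiding (hT : T.IsTree) {a b : V} (hne : c ≠ x)
    (ha : a ∈ branchesAvoiding T c x) (hb : b ∈ branchesAvoiding T x c) :
    Disjoint (side T a c) (side T b x) := by
  refine disjoint_side hT hb.1.symm (fun hab => ?_) ha.2
  have hax : a ≠ x := by
    rintro rfl
    exact notMem_side hT.isAcyclic hb.1.symm hab
  refine hb.2 (mem_side_of_adj hab ha.1.symm fun he => ?_)
  exact (Sym2.eq_iff.1 he).elim (fun h => hne h.2) fun h => hax h.1

theorem degree_add_degree_le_r_one_add_two [Finite V] [T.LocallyFinite] (hT : T.IsTree)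
    (hne : c ≠ x) : T.degree c + T.degree x ≤ r T 1 + 2 := by
  have hsides : ∀ a b, (branchesAvoiding T a b ×ˢ {a}).PairwiseDisjoint
      fun d : V × V => side T d.1 d.2 := by
    rintro a b ⟨u, _⟩ ⟨hu, rfl⟩ ⟨w, _⟩ ⟨hw, rfl⟩ huw
    exact pairwiseDisjoint_side hT.isAcyclic _ hu.1 hw.1 fun h => huw (congrArg (·, _) h)
  have hcross : ∀ d ∈ branchesAvoiding T c x ×ˢ {c}, ∀ e ∈ branchesAvoiding T x c ×ˢ {x},
      d ≠ e → Disjoint (side T d.1 d.2) (side T e.1 e.2) := by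
    rintro ⟨u, _⟩ ⟨hu, rfl⟩ ⟨w, _⟩ ⟨hw, rfl⟩ -
    exact disjoint_side_of_mem_branchesAvoiding hT hne hu hw
  have hpack : (branchesAvoiding T c x ×ˢ {c} ∪ branchesAvoiding T x c ×ˢ {x}).ncard ≤ r T 1 := by
    refine ncard_le_ncard_of_side_subset (v := c) hT.connected
      ((hsides c x).union (hsides x c) hcross) ?_ ?_
    · rintro ⟨u, _⟩ (⟨hu, rfl⟩ | ⟨hu, rfl⟩)
      · exact notMem_side hT.isAcyclic hu.1.symm
      · exact hu.2
    · rintro ⟨u, v⟩ huv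
      have hadj : T.Adj u v := by
        rcases huv with ⟨hu, rfl⟩ | ⟨hu, rfl⟩ <;> exact hu.1.symm
      obtain ⟨a, b, hab, hsub, hmu⟩ := exists_side_subset_mu_eq_one hT.isAcyclic hadj
      exact ⟨a, b, hsub, hab, hmu⟩
  have hdisjoint : Disjoint (branchesAvoiding T c x ×ˢ {c}) (branchesAvoiding T x c ×ˢ {x}) :=
    Set.disjoint_prod.2 (Or.inr (Set.disjoint_singleton.2 hne))
  have hcard := Set.ncard_union_eq hdisjoint
  rw [Set.ncard_prod, Set.ncard_prod, Set.ncard_singleton, Set.ncard_singleton] at hcard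
  have hc := degree_le_ncard_branchesAvoiding_add_one hT.isAcyclic c x
  have hx := degree_le_ncard_branchesAvoiding_add_one hT.isAcyclic x c
  omega

theorem sideCard_le_sideCard_add_one [Finite V] (hx : ∀ z, T.Adj x z → z = y ∨ z = w) :
    sideCard T x y ≤ sideCard T w x + 1 := by
  have hsub : side T x y ⊆ insert x (side T w x) := by
    refine side_subset_of_forall_adj (Set.mem_insert _ _) fun u hu _ z huz hne => ?_
    by_cases hzx : z = x
    · exact Or.inl hzx
    · rcases hu with rfl | hu
      · rcases hx z huz with rfl | rfl
        · exact absurd rfl hne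
        · exact Or.inr (self_mem_side T _ _)
      · by_cases he : s(u, z) = s(w, x)
        · rcases Sym2.eq_iff.1 he with ⟨-, rfl⟩ | ⟨-, rfl⟩
          · exact absurd rfl hzx
          · exact Or.inr (self_mem_side T _ _)
        · exact Or.inr (mem_side_of_adj hu huz he)
  rw [sideCard_eq_ncard_side, sideCard_eq_ncard_side]
  exact (Set.ncard_le_ncard hsub).trans (Set.ncard_insert_le _ _)

theorem exists_side_subset_sideCard_eq [Finite V] [T.LocallyFinite] (hT : T.IsAcyclic)
    (h : T.Adj x y) (hdeg : ∀ v ∈ side T x y, T.degree v ≤ 2) (hj₁ : 1 ≤ j)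
    (hj : j ≤ sideCard T x y) :
    ∃ a b, T.Adj a b ∧ side T a b ⊆ side T x y ∧ sideCard T a b = j := by
  obtain ⟨a, b, hab, hsub, hle, hmin⟩ := exists_minimal_side h hj
  refine ⟨a, b, hab, hsub, le_antisymm ?_ hle⟩
  by_contra! hlt
  obtain ⟨w, haw, hwb⟩ := exists_adj_ne_of_one_lt_sideCard (hj₁.trans_lt hlt)
  have := hmin w a haw.symm (side_ssubset_side hT haw hwb)
  have := sideCard_le_sideCard_add_one fun z =>
    eq_or_eq_of_degree_le_two (hdeg a (hsub (self_mem_side T a b))) hab haw hwb.symm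
  omega

theorem ncard_setOf_adj_one_lt_degree_le_r_two [Finite V] [T.LocallyFinite] (hT : T.IsTree)
    (hdeg : ∀ v ≠ c, T.degree v ≤ 2) (hcard : 4 ≤ Nat.card V) :
    {w | T.Adj c w ∧ 1 < T.degree w}.ncard ≤ r T 2 := by
  refine ncard_le_ncard_of_side_subset hT.connected
    ((pairwiseDisjoint_side hT.isAcyclic c).subset fun w hw => hw.1)
    (fun w hw => notMem_side hT.isAcyclic hw.1.symm) fun w ⟨hcw, hw⟩ => ?_
  obtain ⟨z, hz, hzc⟩ := Finset.exists_mem_ne hw c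
  have hlt := side_ssubset_side hT.isAcyclic ((SimpleGraph.mem_neighborFinset _ _ _).1 hz) hzc
  have htwo : 2 ≤ sideCard T w c := by
    have := one_le_sideCard T z w
    rw [sideCard_eq_ncard_side] at this ⊢
    exact this.trans_lt (Set.ncard_lt_ncard hlt)
  obtain ⟨a, b, hab, hsub, heq⟩ := exists_side_subset_sideCard_eq hT.isAcyclic hcw.symm
    (fun v hv => hdeg v fun hvc => notMem_side hT.isAcyclic hcw.symm (hvc ▸ hv)) one_le_two htwo
  have := sideCard_add_sideCard hT hab
  exact ⟨a, b, hsub, hab, by rw [mu_mk]; omega⟩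

theorem IsBroomHeight.nonempty_iso_of_sameVector {W : Type*} {G : SimpleGraph W} {k : ℕ}
    {p : W → ℕ} [Finite V] [Finite W] [T.LocallyFinite] (h : IsBroomHeight G k p) (hk : 1 ≤ k)
    (hT : T.IsTree) (hcard : Nat.card V = Nat.card W) (hc : 3 ≤ T.degree c)
    (hck : T.degree c + k = Nat.card V) (hsame : SameVector (Nat.card V) T G) :
    Nonempty (T ≃g G) := by
  have hone : r T 1 + k ≤ Nat.card V := by
    rw [hsame 1 (Finset.mem_Icc.2 (by omega)), hcard]
    exact h.r_one_add_le (by omega)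
  have htwo : r T 2 ≤ 1 := by
    rw [hsame 2 (Finset.mem_Icc.2 (by omega))]
    exact h.r_two_le_one hk (by omega)
  have hdeg : ∀ v ≠ c, T.degree v ≤ 2 := fun v hv => by
    have := degree_add_degree_le_r_one_add_two hT hv
    omega
  have hbranch := ncard_setOf_adj_one_lt_degree_le_r_two hT hdeg (by omega)
  obtain ⟨o, ho, hT'⟩ := exists_isBroomHeight_dist hT (by omega) hdeg fun a ha b hb =>
    (Set.ncard_le_one (Set.toFinite _)).1 (hbranch.trans htwo) a ha b hb
  have := hT'.degree_add_eq_card ho rfl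
  obtain rfl : T.dist o c = k := by omega
  exact hT'.nonempty_iso h hcard

end Uniqueness

open Classical in
theorem IsTreeOfMaxDegree.exists_degree_eq {V : Type*} [Fintype V] {n Δ : ℕ} {T : SimpleGraph V}
    (hT : IsTreeOfMaxDegree n Δ T) : ∃ c, T.degree c = Δ := by
  have := hT.isTree.connected.nonempty
  obtain ⟨c, hc⟩ := T.exists_maximal_degree_vertex
  exact ⟨c, hc.symm.trans hT.maxDegree_eq⟩

end EdgeDivision

theorem mainTheorem6 (n Δ : ℕ) (h₂ : 2 < Δ) (hn : Δ < n - 1) :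
    EdgeDivision.IsTreeOfMaxDegree n Δ (EdgeDivision.doubleStarPath n 1 (Δ - 1)) ∧
    ∀ (V : Type*) [Fintype V] (T : SimpleGraph V), EdgeDivision.IsTreeOfMaxDegree n Δ T →
      EdgeDivision.Preceq n T (EdgeDivision.doubleStarPath n 1 (Δ - 1)) ∧
      (EdgeDivision.SameVector n T (EdgeDivision.doubleStarPath n 1 (Δ - 1)) ↔
        Nonempty (T ≃g EdgeDivision.doubleStarPath n 1 (Δ - 1))) := by
  classical
  have hbroom := EdgeDivision.isBroomHeight_doubleStarPath (n := n) (b := Δ - 1) (by omega)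
    (by omega)
  have hcard : Fintype.card (Fin (n - (1 + (Δ - 1))) ⊕ (Fin 1 ⊕ Fin (Δ - 1))) = n := by
    simp only [Fintype.card_sum, Fintype.card_fin]
    omega
  refine ⟨hbroom.isTreeOfMaxDegree (by omega) hcard (by omega) (by omega), fun V _ T hT => ?_⟩
  obtain ⟨c, hc⟩ := hT.exists_degree_eq
  have hV : Nat.card V = n := Nat.card_eq_fintype_card.trans hT.card_eq
  rw [← Nat.card_eq_fintype_card] at hcard
  subst hV
  have hdegree : T.degree c + (Nat.card V - (1 + (Δ - 1))) = Nat.card V := by omega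
  refine ⟨hbroom.preceq hT.isTree hcard.symm hdegree, fun hsame => ?_,
    fun ⟨f⟩ i _ => EdgeDivision.r_iso f i⟩
  exact hbroom.nonempty_iso_of_sameVector (by omega) hT.isTree hcard.symm (by omega) hdegree hsame
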